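/- Let $G$ be a second countable locally compact Hausdorff topological group, and let $\mathrm{Sub}(G)$ be the space of closed subgroups of $G$ with the Chabauty topology, that is, the topology generated by the sets $\{H : H\cap K=\emptyset\}$ with $K\subseteq G$ compact and $\{H : H\cap U\neq\emptyset\}$ with $U\subseteq G$ open. A $G$-flow is a compact Hausdorff space with a (jointly) continuous action of $G$, and a $G$-map is a continuous $G$-equivariant map between $G$-flows. An irreducible extension of a $G$-flow $X$ is a surjective $G$-map $\pi\colon Y\to X$, with $Y$ a $G$-flow, such that every non-empty open subset of $Y$ contains a fiber $\pi^{-1}(\{x\})$ for some $x\in X$. The universal irreducible extension of $X$ is the irreducible extension $\pi_X\colon \hat X_G\to X$, unique up to isomorphism, such that for every irreducible extension $\pi\colon Y\to X$ there is a $G$-map $p\colon \hat X_G\to Y$ with $\pi\circ p=\pi_X$. The stabilizer flow of $X$ is $\mathrm{S}_G(X)=\{G_z : z\in\hat X_G\}\subseteq \mathrm{Sub}(G)$, where $G_z$ is the stabilizer of $z$. Then for every $G$-flow $X$, the set $X_0\subseteq X$ of continuity points of the stabilizer map $\mathrm{Stab}\colon X\to \mathrm{Sub}(G)$, $x\mapsto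 G_x$, is a dense $G_\delta$ subset of $X$, and $$\mathrm{S}_G(X)=\overline{\mathrm{Stab}(X_0)},$$ where the closure is taken in $\mathrm{Sub}(G)$. -/

import Mathlib

universe u v

namespace GFlow

section Chabauty

/-- The Chabauty topology on the closed subsets of `Y`: generated by the sets
`{F | F ∩ K = ∅}` for `K` compact and `{F | F ∩ U ≠ ∅}` for `U` open. -/
@[reducible] def chabauty (Y : Type*) [TopologicalSpace Y] : TopologicalSpace (TopologicalSpace.Closeds Y) :=
  TopologicalSpace.generateFrom
    ({S | ∃ K : Set Y, IsCompact K ∧ S = {F : TopologicalSpace.Closeds Y | (F : Set Y) ∩ K = ∅}} ∪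
      {S | ∃ U : Set Y, IsOpen U ∧ S = {F : TopologicalSpace.Closeds Y | ((F : Set Y) ∩ U).Nonempty}})

/-- A closed subgroup, viewed as a closed subset. -/
def toCloseds {G : Type*} [Group G] [TopologicalSpace G] (H : ClosedSubgroup G) :
    TopologicalSpace.Closeds G :=
  ⟨(H.toSubgroup : Set G), H.isClosed'⟩

/-- The space `Sub(G)` of closed subgroups of `G`, as a subspace of the space of closed subsets
with the Chabauty topology. -/
instance subTopology (G : Type*) [Group G] [TopologicalSpace G] :
    TopologicalSpace (ClosedSubgroup G) :=
  TopologicalSpace.induced toCloseds (chabauty G)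

end Chabauty

section Flows

/-! A `G`-flow is a compact Hausdorff space with a (jointly) continuous action of `G`:
`[TopologicalSpace X] [CompactSpace X] [T2Space X] [MulAction G X] [ContinuousSMul G X]`. -/

variable (G : Type v) [Group G] [TopologicalSpace G]

/-- The stabilizer map `x ↦ G_x`, with values in `Sub(G)`. -/
def stabilizerMap {X : Type*} [TopologicalSpace X] [T2Space X] [MulAction G X]
    [ContinuousSMul G X] (x : X) : ClosedSubgroup G where
  toSubgroup := MulAction.stabilizer G x
  isClosed' := isClosed_eq (continuous_id.smul continuous_const) continuous_const

/-- The set of continuity points of the stabilizer map. -/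
def continuityPoints (X : Type*) [TopologicalSpace X] [T2Space X] [MulAction G X]
    [ContinuousSMul G X] : Set X :=
  {x | ContinuousAt (stabilizerMap G : X → ClosedSubgroup G) x}

/-- `G`-maps: continuous equivariant maps. -/
structure IsGMap {Y X : Type*} [TopologicalSpace Y] [TopologicalSpace X]
    [MulAction G Y] [MulAction G X] (π : Y → X) : Prop where
  continuous : Continuous π
  map_smul : ∀ (g : G) (y : Y), π (g • y) = g • π y

/-- Irreducible extensions: surjective `G`-maps such that every non-empty open subset of the
source contains a fiber. -/
structure IsIrreducibleExtension {Y X : Type*} [TopologicalSpace Y] [TopologicalSpace X]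
    [MulAction G Y] [MulAction G X] (π : Y → X) : Prop extends IsGMap G π where
  surjective : Function.Surjective π
  exists_fiber_subset : ∀ U : Set Y, IsOpen U → U.Nonempty → ∃ x : X, π ⁻¹' {x} ⊆ U

/-- The extension `π : Y → X` of `G`-flows is the universal irreducible extension of `X`: it is
irreducible, and it factors through every irreducible extension `ρ : Z → X` by a `G`-flow `Z`. -/
structure IsUniversalIrreducibleExtension {Y X : Type u} [TopologicalSpace Y]
    [TopologicalSpace X] [MulAction G Y] [MulAction G X] (π : Y → X) : Prop
    extends IsIrreducibleExtension G π where
  exists_lift : ∀ (Z : Type u) [TopologicalSpace Z] [CompactSpace Z] [T2Space Z]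
    [MulAction G Z] [ContinuousSMul G Z] (ρ : Z → X), IsIrreducibleExtension G ρ →
    ∃ p : Y → Z, IsGMap G p ∧ ∀ y, ρ (p y) = π y

/-- The identity is the only continuous self-map of an irreducible extension over its base. -/
theorem IsIrreducibleExtension.eq_of_comp {G : Type*} [Group G] {Y X : Type*} [TopologicalSpace Y] [T2Space Y]
    [TopologicalSpace X] [MulAction G Y] [MulAction G X] {π : Y → X}
    (h : IsIrreducibleExtension G π) {f : Y → Y} (hf : Continuous f)
    (hπ : ∀ y, π (f y) = π y) (y : Y) : f y = y := by
  by_contra hne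
  obtain ⟨A, B, hA, hB, hyA, hyB, hAB⟩ := t2_separation hne
  obtain ⟨x, hx⟩ := h.exists_fiber_subset (B ∩ f ⁻¹' A) (hB.inter (hA.preimage hf)) ⟨y, hyB, hyA⟩
  obtain ⟨z, rfl⟩ := h.surjective x
  exact Set.disjoint_left.1 hAB (hx (rfl : π z = π z)).2 (hx (hπ z)).1

/-- The stabilizer flow `S_G(X) = {G_z : z ∈ X̂_G}`, where `X̂_G` is the universal irreducible
extension of `X`. The choice of a representative of `X̂_G` does not matter, see
`stabilizerFlow_eq_range`. -/
def stabilizerFlow (X : Type u) [TopologicalSpace X] [MulAction G X] :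
    Set (ClosedSubgroup G) :=
  {H | ∃ (Y : Type u) (_ : TopologicalSpace Y) (_ : CompactSpace Y) (_ : T2Space Y)
    (_ : MulAction G Y) (_ : ContinuousSMul G Y) (π : Y → X),
    IsUniversalIrreducibleExtension G π ∧ ∃ z : Y, stabilizerMap G z = H}

variable {G}

/-- The stabilizer flow is the image of the stabilizer map of any universal irreducible
extension. -/
theorem stabilizerFlow_eq_range {X Y : Type u} [TopologicalSpace X] [MulAction G X]
    [TopologicalSpace Y] [CompactSpace Y] [T2Space Y] [MulAction G Y] [ContinuousSMul G Y]
    {π : Y → X} (h : IsUniversalIrreducibleExtension G π) :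
    stabilizerFlow G X = Set.range (stabilizerMap G : Y → ClosedSubgroup G) := by
  ext H
  constructor
  · rintro ⟨Z, _, _, _, _, _, ρ, hρ, z, rfl⟩
    obtain ⟨p, hp, hpρ⟩ := h.exists_lift Z ρ hρ.toIsIrreducibleExtension
    obtain ⟨q, hq, hqπ⟩ := hρ.exists_lift Y π h.toIsIrreducibleExtension
    have hpq : ∀ w, p (q w) = w :=
      hρ.toIsIrreducibleExtension.eq_of_comp (hp.continuous.comp hq.continuous)
        (fun w => (hpρ _).trans (hqπ w))
    refine ⟨q z, ?_⟩
    have hs : MulAction.stabilizer G (q z) = MulAction.stabilizer G z := by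
      ext g
      simp only [MulAction.mem_stabilizer_iff]
      constructor
      · intro hg
        rw [← hpq z, ← hp.map_smul, hg]
      · intro hg
        rw [← hq.map_smul, hg]
    simp only [stabilizerMap, hs]
  · rintro ⟨z, rfl⟩
    exact ⟨Y, _, inferInstance, inferInstance, _, inferInstance, π, h, z, rfl⟩

end Flows

end GFlow

namespace GFlow

open Set Topology Filter

/-! ### Convergence and separation in `Sub(G)` -/

section Chabauty

variable {G : Type*} [Group G] [TopologicalSpace G]

/-! Stabilizers are automatically upper semicontinuous, so continuity at a point only asks that an
approximate stabilizing element persist nearby. A Baire argument over a countable basis of `G` then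
makes the continuity set `X₀` a dense Gδ.

For the formula it suffices to have a universal irreducible extension `Y` whose stabilizer map is
continuous. Irreducibility makes the preimage of `X₀` dense in `Y` and keeps stabilizers unchanged
over `X₀`. The range of the stabilizer map of `Y` is compact, hence closed, so it is the closure of
`Stab(X₀)`.

To build `Y`, take the Gleason cover `E` of `X`. Lifts to `E` are unique, so `G` acts on it, though
perhaps not jointly continuously; `Y` is the largest quotient where the action is jointly
continuous. `Y` keeps a uniform trace of extremal disconnectedness: open `A`, `B` with `W • A`
disjoint from `B`, for a neighborhood `W` of `1`, have disjoint closures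
(`exists_jointlyContinuous_separating`). In the spirit of Frolík's theorem on fixed points in
extremally disconnected spaces, a finite coloring (`exists_finite_coloring`) turns this into
continuity of stabilizers. -/

theorem isOpen_setOf_disjoint {K : Set G} (hK : IsCompact K) :
    IsOpen {H : ClosedSubgroup G | ∀ g ∈ K, g ∉ H.toSubgroup} := by
  refine ⟨_, TopologicalSpace.isOpen_generateFrom_of_mem (Or.inl ⟨K, hK, rfl⟩), ?_⟩
  ext H
  simp only [toCloseds, mem_preimage, mem_ofPred_eq, eq_empty_iff_forall_notMem]
  exact ⟨fun h g hg hH => h g ⟨hH, hg⟩, fun h g hg => h g hg.2 hg.1⟩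

theorem isOpen_setOf_meets {U : Set G} (hU : IsOpen U) :
    IsOpen {H : ClosedSubgroup G | ∃ g ∈ U, g ∈ H.toSubgroup} := by
  refine ⟨_, TopologicalSpace.isOpen_generateFrom_of_mem (Or.inr ⟨U, hU, rfl⟩), ?_⟩
  ext H
  exact ⟨fun ⟨g, hH, hg⟩ => ⟨g, hg, hH⟩, fun ⟨g, hg, hH⟩ => ⟨g, hH, hg⟩⟩

theorem tendsto_closedSubgroup_iff {Z : Type*} {l : Filter Z} {f : Z → ClosedSubgroup G}
    {H : ClosedSubgroup G} :
    Tendsto f l (𝓝 H) ↔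
      (∀ K, IsCompact K → (∀ g ∈ K, g ∉ H.toSubgroup) →
        ∀ᶠ z in l, ∀ g ∈ K, g ∉ (f z).toSubgroup) ∧
      (∀ U, IsOpen U → (∃ g ∈ U, g ∈ H.toSubgroup) →
        ∀ᶠ z in l, ∃ g ∈ U, g ∈ (f z).toSubgroup) := by
  constructor
  · intro h
    exact ⟨fun K hK hH => h.eventually ((isOpen_setOf_disjoint hK).mem_nhds hH),
      fun U hU hH => h.eventually ((isOpen_setOf_meets hU).mem_nhds hH)⟩
  · rintro ⟨h₁, h₂⟩
    let := chabauty G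
    rw [nhds_induced, tendsto_comap_iff, TopologicalSpace.tendsto_nhds_generateFrom_iff]
    rintro s (⟨K, hK, rfl⟩ | ⟨U, hU, rfl⟩) hs
    · refine (h₁ K hK fun g hg hH => ?_).mono fun z hz => ?_
      · exact (hs : _ = ∅).le ⟨hH, hg⟩
      · exact eq_empty_of_forall_notMem fun g hg => hz g hg.2 hg.1
    · obtain ⟨g, hH, hg⟩ := hs
      exact (h₂ U hU ⟨g, hg, hH⟩).mono fun z ⟨g, hg, hz⟩ => ⟨g, hz, hg⟩

/-- The Chabauty space of a locally compact Hausdorff group is Hausdorff. -/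
instance [LocallyCompactSpace G] [T2Space G] : T2Space (ClosedSubgroup G) := by
  have key : ∀ H H' : ClosedSubgroup G, ∀ g, g ∈ H.toSubgroup → g ∉ H'.toSubgroup →
      ∃ u v : Set (ClosedSubgroup G), IsOpen u ∧ IsOpen v ∧ H ∈ u ∧ H' ∈ v ∧ Disjoint u v := by
    intro H H' g hg hg'
    obtain ⟨K, hK, hgK, hKH⟩ := exists_compact_subset H'.isClosed'.isOpen_compl hg'
    refine ⟨_, _, isOpen_setOf_meets isOpen_interior, isOpen_setOf_disjoint hK, ⟨g, hgK, hg⟩,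
      fun k hk hk' => hKH hk hk', disjoint_left.2 ?_⟩
    rintro L ⟨k, hk, hkL⟩ hL
    exact hL k (interior_subset hk) hkL
  refine ⟨fun H H' hne => ?_⟩
  by_cases h : ∃ g, g ∈ H.toSubgroup ∧ g ∉ H'.toSubgroup
  · obtain ⟨g, hg, hg'⟩ := h
    exact key H H' g hg hg'
  · by_cases h' : ∃ g, g ∈ H'.toSubgroup ∧ g ∉ H.toSubgroup
    · obtain ⟨g, hg, hg'⟩ := h'
      obtain ⟨u, v, hu, hv, hHu, hHv, huv⟩ := key H' H g hg hg'
      exact ⟨v, u, hv, hu, hHv, hHu, huv.symm⟩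
    · push Not at h h'
      exact (hne (ClosedSubgroup.ext (Set.ext fun g => ⟨h g, h' g⟩))).elim

end Chabauty

/-! ### Semicontinuity of stabilizers and genericity of continuity points -/

section StabilizerMap

variable {G : Type*} [Group G] [TopologicalSpace G]
  {X : Type*} [TopologicalSpace X] [CompactSpace X] [T2Space X] [MulAction G X] [ContinuousSMul G X]

theorem isClosed_setOf_exists_smul_eq {K : Set G} (hK : IsCompact K) :
    IsClosed {p : X × X | ∃ g ∈ K, g • p.1 = p.2} := by
  have hc : Continuous fun q : G × X => (q.2, q.1 • q.2) := by fun_prop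
  convert ((hK.prod (isCompact_univ (X := X))).image hc).isClosed using 1
  ext ⟨x, y⟩
  constructor
  · rintro ⟨g, hg, h⟩
    exact ⟨(g, x), ⟨hg, mem_univ _⟩, Prod.ext rfl h⟩
  · rintro ⟨⟨g, z⟩, ⟨hg, -⟩, h⟩
    simp only [Prod.mk.injEq] at h
    obtain ⟨rfl, rfl⟩ := h
    exact ⟨g, hg, rfl⟩

theorem isClosed_setOf_exists_fixed {K : Set G} (hK : IsCompact K) (a : G) :
    IsClosed {x : X | ∃ g ∈ K, g • a • x = x} :=
  (isClosed_setOf_exists_smul_eq (X := X) hK).preimage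
    (f := fun x : X => (a • x, x)) (by fun_prop)

/-- The stabilizer map is upper semicontinuous, so that only lower semicontinuity is needed for
continuity. -/
theorem continuousAt_stabilizerMap_iff {x : X} :
    ContinuousAt (stabilizerMap G : X → ClosedSubgroup G) x ↔
      ∀ U : Set G, IsOpen U → (∃ g ∈ U, g • x = x) → ∀ᶠ y in 𝓝 x, ∃ g ∈ U, g • y = y := by
  refine tendsto_closedSubgroup_iff.trans ⟨fun h => h.2, fun h => ⟨fun K hK hx => ?_, h⟩⟩
  have := (isClosed_setOf_exists_fixed (X := X) hK 1).isOpen_compl.mem_nhds (x := x) ?_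
  · filter_upwards [this] with y hy g hg hgy
    exact hy ⟨g, hg, by rw [one_smul]; exact hgy⟩
  · rintro ⟨g, hg, hgx⟩
    rw [one_smul] at hgx
    exact hx g hg hgx

/-- Each basic open `U` is a countable union of compact sets `K n`. The points fixed by some element
of `K n` form a closed set, and continuity says exactly that each of them is interior to the set of
points fixed by some element of `U`. Each such condition defines a dense open set, so Baire applies.
-/
theorem dense_and_isGδ_continuityPoints [LocallyCompactSpace G]
    [SecondCountableTopology G] :
    Dense (continuityPoints G X) ∧ IsGδ (continuityPoints G X) := by
  let B := TopologicalSpace.countableBasis G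
  have hB := TopologicalSpace.isBasis_countableBasis G
  have hK : ∀ U : B, ∃ K : ℕ → Set G, (∀ n, IsCompact (K n)) ∧ ⋃ n, K n = U := by
    rintro ⟨U, hU⟩
    have : LocallyCompactSpace U := (hB.isOpen hU).locallyCompactSpace
    exact isSigmaCompact_iff_sigmaCompactSpace.2 inferInstance
  choose K hKc hKU using hK
  let A : Set G → Set X := fun S => {x | ∃ g ∈ S, g • x = x}
  let O : B × ℕ → Set X := fun p => (A (K p.1 p.2))ᶜ ∪ interior (A p.1)
  have hsub : ∀ p : B × ℕ, A (K p.1 p.2) ⊆ A p.1 := fun p x ⟨g, hg, hx⟩ =>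
    ⟨g, hKU p.1 ▸ mem_iUnion_of_mem p.2 hg, hx⟩
  have hO : ∀ p, IsOpen (O p) := by
    intro p
    refine IsOpen.union (IsClosed.isOpen_compl (self := ?_)) isOpen_interior
    simpa using isClosed_setOf_exists_fixed (X := X) (hKc p.1 p.2) 1
  have hd : ∀ p, Dense (O p) := by
    intro p
    rw [dense_iff_inter_open]
    rintro V hV ⟨x, hx⟩
    by_contra hne
    have hVA : V ⊆ A (K p.1 p.2) := fun y hy => by
      by_contra hyA
      exact hne ⟨y, hy, Or.inl hyA⟩
    exact hne ⟨x, hx, Or.inr (interior_maximal (hVA.trans (hsub p)) hV hx)⟩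
  have heq : continuityPoints G X = ⋂ p, O p := by
    ext x
    simp only [continuityPoints, mem_ofPred_eq, continuousAt_stabilizerMap_iff, mem_iInter]
    constructor
    · intro h p
      by_cases hx : x ∈ A (K p.1 p.2)
      · exact Or.inr (mem_interior_iff_mem_nhds.2 (h _ (hB.isOpen p.1.2) (hsub p hx)))
      · exact Or.inl hx
    · rintro h U hU ⟨g, hg, hgx⟩
      obtain ⟨W, hW, hgW, hWU⟩ := hB.exists_subset_of_mem_open hg hU
      have hgW' : g ∈ ⋃ n, K ⟨W, hW⟩ n := by rw [hKU]; exact hgW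
      obtain ⟨n, hn⟩ := mem_iUnion.1 hgW'
      rcases h (⟨W, hW⟩, n) with hx | hx
      · exact (hx ⟨g, hn, hgx⟩).elim
      · exact mem_of_superset (mem_interior_iff_mem_nhds.1 hx)
          fun y ⟨k, hk, hy⟩ => ⟨k, hWU hk, hy⟩
  have : Countable B := (TopologicalSpace.countable_countableBasis G).to_subtype
  rw [heq]
  exact ⟨dense_iInter_of_isOpen hO hd, IsGδ.iInter_of_isOpen hO⟩

end StabilizerMap

/-! ### Stabilizers in irreducible extensions -/

section Irreducible

variable {G : Type*} [Group G] {X Y : Type*} [TopologicalSpace X] [T2Space X] [MulAction G X]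
  [TopologicalSpace Y] [CompactSpace Y] [MulAction G Y] {π : Y → X}

/-- An open set of the source of an irreducible extension contains the preimage of an open set. -/
theorem IsIrreducibleExtension.exists_isOpen_preimage_subset (h : IsIrreducibleExtension G π)
    {U : Set Y} (hU : IsOpen U) (hne : U.Nonempty) :
    ∃ V : Set X, IsOpen V ∧ V.Nonempty ∧ π ⁻¹' V ⊆ U := by
  obtain ⟨x, hx⟩ := h.exists_fiber_subset U hU hne
  refine ⟨(π '' Uᶜ)ᶜ, (hU.isClosed_compl.isCompact.image h.continuous).isClosed.isOpen_compl,
    ⟨x, ?_⟩, ?_⟩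
  · rintro ⟨y, hy, rfl⟩
    exact hy (hx rfl)
  · intro y hy
    by_contra hyU
    exact hy ⟨y, hyU, rfl⟩

theorem IsIrreducibleExtension.dense_preimage (h : IsIrreducibleExtension G π) {D : Set X}
    (hD : Dense D) : Dense (π ⁻¹' D) := by
  rw [dense_iff_inter_open]
  intro U hU hne
  obtain ⟨V, hV, hVne, hVU⟩ := h.exists_isOpen_preimage_subset hU hne
  obtain ⟨x, hxV, hxD⟩ := hD.inter_open_nonempty V hV hVne
  obtain ⟨y, rfl⟩ := h.surjective x
  exact ⟨y, hVU hxV, hxD⟩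

variable [TopologicalSpace G] [CompactSpace X] [ContinuousSMul G X] [T2Space Y]
  [ContinuousSMul G Y]

/-- Over a continuity point of the stabilizer map, stabilizers do not change in an irreducible
extension. -/
theorem IsIrreducibleExtension.stabilizerMap_eq [IsTopologicalGroup G] [LocallyCompactSpace G]
    (h : IsIrreducibleExtension G π) {y : Y} (hy : π y ∈ continuityPoints G X) :
    stabilizerMap G y = stabilizerMap G (π y) := by
  suffices hs : MulAction.stabilizer G y = MulAction.stabilizer G (π y) by
    simp only [stabilizerMap, hs]
  ext g
  simp only [MulAction.mem_stabilizer_iff]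
  refine ⟨fun hg => by rw [← h.map_smul, hg], fun hg => ?_⟩
  by_contra hgy
  have hcl : IsClosed {k : G | k • y = y} :=
    isClosed_eq (continuous_id.smul continuous_const) continuous_const
  obtain ⟨K, hK, hgK, hKy⟩ := exists_compact_subset hcl.isOpen_compl (x := g) hgy
  have hmem : {p : Y × Y | ∃ k ∈ K, k • p.1 = p.2}ᶜ ∈ 𝓝 (y, y) :=
    (isClosed_setOf_exists_smul_eq hK).isOpen_compl.mem_nhds fun ⟨k, hk, hky⟩ => hKy hk hky
  obtain ⟨N, hN, hyN, hNsub⟩ : ∃ N : Set Y, IsOpen N ∧ y ∈ N ∧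
      N ×ˢ N ⊆ {p : Y × Y | ∃ k ∈ K, k • p.1 = p.2}ᶜ := by
    rw [nhds_prod_eq, mem_prod_self_iff] at hmem
    obtain ⟨t, ht, hts⟩ := hmem
    obtain ⟨N, hNt, hN, hyN⟩ := mem_nhds_iff.1 ht
    exact ⟨N, hN, hyN, (prod_mono hNt hNt).trans hts⟩
  -- Near `π y` every point is fixed by an element of `interior K`, which then preserves the fiber
  -- over it. A whole fiber inside `N` contradicts that `K` moves `N` off itself.
  obtain ⟨V, hVsub, hV, hyV⟩ := mem_nhds_iff.1
    (continuousAt_stabilizerMap_iff.1 hy _ isOpen_interior ⟨g, hgK, hg⟩)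
  obtain ⟨x, hx⟩ := h.exists_fiber_subset (N ∩ π ⁻¹' V) (hN.inter (hV.preimage h.continuous))
    ⟨y, hyN, hyV⟩
  obtain ⟨z, rfl⟩ := h.surjective x
  obtain ⟨k, hk, hkz⟩ := hVsub (hx rfl : z ∈ _).2
  have hkz' : k • z ∈ N := (hx (by simp [h.map_smul, hkz] : k • z ∈ π ⁻¹' {π z})).1
  exact hNsub (mk_mem_prod (hx rfl : z ∈ _).1 hkz') ⟨k, interior_subset hk, rfl⟩

theorem IsUniversalIrreducibleExtension.stabilizerFlow_eq_closure {G : Type v} [Group G]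
    [TopologicalSpace G] [IsTopologicalGroup G]
    [LocallyCompactSpace G] [T2Space G] {X Y : Type u}
    [TopologicalSpace X] [CompactSpace X] [T2Space X] [MulAction G X] [ContinuousSMul G X]
    [TopologicalSpace Y] [CompactSpace Y] [T2Space Y] [MulAction G Y] [ContinuousSMul G Y]
    {π : Y → X} (h : IsUniversalIrreducibleExtension G π)
    (hd : Dense (continuityPoints G X))
    (hc : Continuous (stabilizerMap G : Y → ClosedSubgroup G)) :
    stabilizerFlow G X =
      closure ((stabilizerMap G : X → ClosedSubgroup G) '' continuityPoints G X) := by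
  have hi := h.toIsIrreducibleExtension
  rw [stabilizerFlow_eq_range h]
  apply Subset.antisymm
  · rintro _ ⟨y, rfl⟩
    have := image_closure_subset_closure_image hc
      (mem_image_of_mem _ (hi.dense_preimage hd y))
    refine closure_mono ?_ this
    rintro _ ⟨z, hz, rfl⟩
    exact ⟨π z, hz, (hi.stabilizerMap_eq hz).symm⟩
  · refine closure_minimal ?_ (isCompact_range hc).isClosed
    rintro _ ⟨x, hx, rfl⟩
    obtain ⟨y, rfl⟩ := hi.surjective x
    exact ⟨y, hi.stabilizerMap_eq hx⟩

end Irreducible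

/-! ### Finite colorings and continuity of the stabilizer map -/

section Coloring

variable {G : Type*} [Group G]
  {X : Type*} [TopologicalSpace X] [MulAction G X]

theorem isOpen_setOf_exists_smul_mem_eq [ContinuousConstSMul G X] (S : Set G)
    {A : Set X} (hA : IsOpen A) :
    IsOpen {y | ∃ s ∈ S, ∃ a ∈ A, s • a = y} := by
  have : {y | ∃ s ∈ S, ∃ a ∈ A, s • a = y} = ⋃ s ∈ S, (fun a => s • a) '' A := by
    ext y; simp
  rw [this]
  exact isOpen_biUnion fun s _ => isOpenMap_smul s A hA

variable [TopologicalSpace G] [IsTopologicalGroup G] [CompactSpace X] [T2Space X] [ContinuousSMul G X]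

/-- If no element of `V * g` fixes a point of the open set `O`, then up to closures and a small
thickening by `S`, the set `O` is a finite union of open sets that `V * g` moves off themselves. -/
theorem exists_finite_coloring {O : Set X} (hO : IsOpen O) {V : Set G} (hV : IsCompact V) (g : G)
    (hVO : ∀ x ∈ O, ∀ v ∈ V, v • g • x ≠ x) {S : Set G} (hS : S ∈ 𝓝 1)
    (hSinv : ∀ s ∈ S, s⁻¹ ∈ S) :
    ∃ (n : ℕ) (A : Fin n → Set X), (∀ i, IsOpen (A i)) ∧
      (∀ i, ∀ x ∈ A i, ∀ w ∈ interior V, w • g • x ∉ A i) ∧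
      O ⊆ closure (⋃ i, {y | ∃ s ∈ S, ∃ a ∈ A i, s • a = y}) := by
  have hN : ∀ v : G, ∃ N ∈ 𝓝 v, ∀ a ∈ N, ∀ b ∈ N, b * a⁻¹ ∈ S ∧ g⁻¹ * (b⁻¹ * a) * g ∈ S := by
    intro v
    have h₁ : ∀ᶠ p : G × G in 𝓝 (v, v), p.2 * p.1⁻¹ ∈ S := by
      have hc : Continuous fun p : G × G => p.2 * p.1⁻¹ := by fun_prop
      exact hc.continuousAt.eventually_mem (by simpa using hS)
    have h₂ : ∀ᶠ p : G × G in 𝓝 (v, v), g⁻¹ * (p.2⁻¹ * p.1) * g ∈ S := by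
      have hc : Continuous fun p : G × G => g⁻¹ * (p.2⁻¹ * p.1) * g := by fun_prop
      exact hc.continuousAt.eventually_mem (by simpa using hS)
    have h := h₁.and h₂
    rw [nhds_prod_eq] at h
    obtain ⟨N, hN, hNs⟩ := mem_prod_self_iff.1 h
    exact ⟨N, hN, fun a ha b hb => hNs (mk_mem_prod ha hb)⟩
  choose N hNv hNS using hN
  obtain ⟨t, -, htV⟩ := hV.elim_nhds_subcover N fun v _ => hNv v
  -- One color more than there are pairs (patch of `V`, direction), for the pigeonhole below.
  let n := Fintype.card (t × Bool) + 1
  -- Besides being moved off themselves, distinct colors are required to be `S`-separated; this is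
  -- what the pigeonhole contradicts.
  let 𝒞 : Set (Fin n → Set X) := {A | (∀ i, IsOpen (A i)) ∧ (∀ i, ∀ x ∈ A i, ∀ w ∈ interior V,
    w • g • x ∉ A i) ∧ ∀ i j, i ≠ j → ∀ x ∈ A i, ∀ s ∈ S, s • x ∉ A j}
  obtain ⟨A, hA⟩ : ∃ A, Maximal (· ∈ 𝒞) A := by
    refine zorn_le₀ 𝒞 fun c hc hchain => ⟨fun i => ⋃ A ∈ c, A i, ⟨?_, ?_, ?_⟩, ?_⟩
    · exact fun i => isOpen_biUnion fun A hA => (hc hA).1 i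
    · intro i x hx w hw hx'
      simp only [mem_iUnion, exists_prop] at hx hx'
      obtain ⟨A, hA, hx⟩ := hx
      obtain ⟨B, hB, hx'⟩ := hx'
      rcases hchain.total hA hB with h | h
      · exact (hc hB).2.1 i x (h i hx) w hw hx'
      · exact (hc hA).2.1 i x hx w hw (h i hx')
    · intro i j hij x hx s hs hx'
      simp only [mem_iUnion, exists_prop] at hx hx'
      obtain ⟨A, hA, hx⟩ := hx
      obtain ⟨B, hB, hx'⟩ := hx'
      rcases hchain.total hA hB with h | h
      · exact (hc hB).2.2 i j hij x (h i hx) s hs hx'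
      · exact (hc hA).2.2 i j hij x hx s hs (h j hx')
    · exact fun A hA i x hx => mem_biUnion hA hx
  obtain ⟨⟨hAo, hAw, hAs⟩, hmax⟩ := hA
  refine ⟨n, A, hAo, hAw, ?_⟩
  set T : Set X := ⋃ i, {y | ∃ s ∈ S, ∃ a ∈ A i, s • a = y} with hT
  have hTmem : ∀ i, ∀ s ∈ S, ∀ a ∈ A i, s • a ∈ T := fun i s hs a ha =>
    mem_iUnion_of_mem i ⟨s, hs, a, ha, rfl⟩
  by_contra hOT
  obtain ⟨x₀, hx₀, hx₀T⟩ := not_subset.1 hOT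
  let O' : Set X := O ∩ (closure T)ᶜ
  have hO' : IsOpen O' := hO.inter isClosed_closure.isOpen_compl
  let D : Fin n → Set X := fun i => A i ∪
    ({y | ∃ w ∈ interior V, ∃ a ∈ (fun x => g⁻¹ • x) ⁻¹' A i, w • a = y} ∪
      {y | ∃ w ∈ interior V, w • g • y ∈ A i})
  have hDo : ∀ i, IsOpen (D i) := by
    intro i
    refine (hAo i).union (IsOpen.union ?_ ?_)
    · exact isOpen_setOf_exists_smul_mem_eq _ ((hAo i).preimage (continuous_const_smul _))
    · have : {y | ∃ w ∈ interior V, w • g • y ∈ A i} =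
          ⋃ w ∈ interior V, (fun y => w • g • y) ⁻¹' A i := by ext y; simp
      rw [this]
      exact isOpen_biUnion fun w _ => (hAo i).preimage (by fun_prop)
  -- `D i` collects the obstructions to giving a point color `i`. A point of `O'` outside its
  -- closure would have a neighborhood that could be added to `A i`, against maximality.
  have hD : ∀ i, O' ⊆ closure (D i) := by
    intro i y hy
    by_contra hyD
    have hyV : {p : X × X | ∃ k ∈ V, k • g • p.1 = p.2}ᶜ ∈ 𝓝 (y, y) := by
      refine IsOpen.mem_nhds (IsClosed.isOpen_compl (self := ?_)) ?_
      · exact (isClosed_setOf_exists_smul_eq (X := X) hV).preimage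
          (f := fun p : X × X => (g • p.1, p.2)) (by fun_prop)
      · exact fun ⟨v, hv, hvy⟩ => hVO y hy.1 v hv hvy
    rw [nhds_prod_eq, mem_prod_self_iff] at hyV
    obtain ⟨M, hM, hMV⟩ := hyV
    have hM' : M ∩ (O' ∩ (closure (D i))ᶜ) ∈ 𝓝 y :=
      inter_mem hM ((hO'.inter isClosed_closure.isOpen_compl).mem_nhds ⟨hy, hyD⟩)
    obtain ⟨P, hPM, hP, hyP⟩ := mem_nhds_iff.1 hM'
    have hPD : ∀ p ∈ P, p ∉ D i := fun p hp h => (hPM hp).2.2 (subset_closure h)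
    have hPT : ∀ p ∈ P, p ∉ T := fun p hp h => (hPM hp).2.1.2 (subset_closure h)
    have hA' : Function.update A i (A i ∪ P) ∈ 𝒞 := by
      refine ⟨fun j => ?_, fun j => ?_, fun j k hjk => ?_⟩
      · rcases eq_or_ne j i with rfl | hj
        · simpa using (hAo j).union hP
        · simpa [hj] using hAo j
      · rcases eq_or_ne j i with rfl | hj
        · simp only [Function.update_self]
          rintro x (hx | hx) w hw (hx' | hx')
          · exact hAw j x hx w hw hx'
          · exact hPD _ hx' (Or.inr (Or.inl ⟨w, hw, g • x, by simpa using hx, rfl⟩))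
          · exact hPD _ hx (Or.inr (Or.inr ⟨w, hw, hx'⟩))
          · exact hMV (mk_mem_prod (hPM hx).1 (hPM hx').1) ⟨w, interior_subset hw, rfl⟩
        · simpa [hj] using hAw j
      · rcases eq_or_ne j i with rfl | hj
        · simp only [Function.update_self, Function.update_of_ne hjk.symm]
          rintro x (hx | hx) s hs hx'
          · exact hAs j k hjk x hx s hs hx'
          · exact hPT x hx (by simpa using hTmem k s⁻¹ (hSinv s hs) _ hx')
        · rw [Function.update_of_ne hj]
          rcases eq_or_ne k i with rfl | hk
          · rw [Function.update_self]
            rintro x hx s hs (hx' | hx')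
            · exact hAs j k hjk x hx s hs hx'
            · exact hPT _ hx' (hTmem j s hs x hx)
          · rw [Function.update_of_ne hk]
            exact hAs j k hjk
    have hle : A ≤ Function.update A i (A i ∪ P) := by
      intro j
      rcases eq_or_ne j i with rfl | hj
      · simp
      · simp [hj]
    have hyA : y ∈ A i := hmax hA' hle i (by simp [hyP])
    exact hPD y hyP (Or.inl hyA)
  have hdense : Dense (⋂ i, (D i ∪ (closure O')ᶜ)) := by
    refine dense_iInter_of_isOpen (fun i => (hDo i).union isClosed_closure.isOpen_compl)
      fun i => dense_iff_inter_open.2 ?_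
    rintro U hU ⟨y, hy⟩
    by_cases hyO : y ∈ closure O'
    · obtain ⟨z, hzU, hzO⟩ := mem_closure_iff.1 hyO U hU hy
      obtain ⟨p, hpU, hpD⟩ := mem_closure_iff.1 (hD i hzO) U hU hzU
      exact ⟨p, hpU, Or.inl hpD⟩
    · exact ⟨y, hy, Or.inr hyO⟩
  obtain ⟨x, hxO, hx⟩ := hdense.inter_open_nonempty O' hO' ⟨x₀, hx₀, hx₀T⟩
  have hcol : ∀ i, ∃ p : t × Bool, ∃ w ∈ N p.1,
      if p.2 then ∃ a ∈ A i, w • g • a = x else w • g • x ∈ A i := by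
    intro i
    have hcov : ∀ w ∈ interior V, ∃ v : t, w ∈ N v := fun w hw => by
      simpa using htV (interior_subset hw)
    rcases mem_iInter.1 hx i with (h | ⟨w, hw, a, ha, h⟩ | ⟨w, hw, h⟩) | h
    · refine (hxO.2 (subset_closure ?_)).elim
      simpa using hTmem i 1 (mem_of_mem_nhds hS) x h
    · obtain ⟨v, hv⟩ := hcov w hw
      exact ⟨(v, true), w, hv, by simpa using ⟨g⁻¹ • a, ha, by simpa using h⟩⟩
    · obtain ⟨v, hv⟩ := hcov w hw
      exact ⟨(v, false), w, hv, by simpa using h⟩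
    · exact (h (subset_closure hxO)).elim
  choose p w hw hpw using hcol
  -- Two colors are reached from `x` in the same direction by elements of the same patch, so the
  -- element relating their points lies in `S`.
  obtain ⟨i, j, hij, hpij⟩ := Fintype.exists_ne_map_eq_of_card_lt p (by simp [n])
  have hwj := hw j
  have hpj := hpw j
  have hwi := hw i
  have hpi := hpw i
  rw [← hpij] at hwj hpj
  have hwS := hNS _ _ hwi _ hwj
  cases hb : (p i).2
  · simp only [hb, Bool.false_eq_true, if_false] at hpi hpj
    refine hAs i j hij _ hpi _ hwS.1 ?_
    simpa [mul_smul] using hpj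
  · simp only [hb, if_true] at hpi hpj
    obtain ⟨a, ha, rfl⟩ := hpi
    obtain ⟨b, hb, hab⟩ := hpj
    refine hAs i j hij _ ha _ hwS.2 ?_
    have : b = (g⁻¹ * ((w j)⁻¹ * w i) * g) • a := by
      simp only [mul_smul, ← hab, inv_smul_smul]
    exact this ▸ hb

/-- If open sets that are uniformly disjoint have disjoint closures, then the stabilizer map is
continuous. -/
theorem continuous_stabilizerMap [LocallyCompactSpace G]
    (hX : ∀ A B : Set X, IsOpen A → IsOpen B → ∀ W ∈ 𝓝 (1 : G),
      (∀ w ∈ W, ∀ a ∈ A, w • a ∉ B) → Disjoint (closure A) (closure B)) :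
    Continuous (stabilizerMap G : X → ClosedSubgroup G) := by
  refine continuous_iff_continuousAt.2 fun z => continuousAt_stabilizerMap_iff.2 ?_
  rintro U hU ⟨g, hgU, hgz⟩
  obtain ⟨V, hV, h1V, hVU⟩ := exists_compact_subset (x := (1 : G))
    (hU.preimage (f := fun v => v * g) (by fun_prop)) (by simpa using hgU)
  let O : Set X := {x | ∃ v ∈ V, v • g • x = x}ᶜ
  have hO : IsOpen O := (isClosed_setOf_exists_fixed hV g).isOpen_compl
  suffices hz : z ∉ closure O by
    filter_upwards [isClosed_closure.isOpen_compl.mem_nhds hz] with y hy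
    have hyO : ¬ y ∈ O := fun h => hy (subset_closure h)
    obtain ⟨v, hv, hvy⟩ := not_not.1 hyO
    exact ⟨v * g, hVU hv, by rw [mul_smul, hvy]⟩
  intro hz
  -- This choice makes `g • (S • A i)` and `S • A i` uniformly disjoint whenever `interior V * g`
  -- moves `A i` off itself.
  obtain ⟨S, hS, hSinv, hSV⟩ : ∃ S ∈ 𝓝 (1 : G), (∀ s ∈ S, s⁻¹ ∈ S) ∧
      ∀ a ∈ S, ∀ b ∈ S, ∀ c ∈ S, a⁻¹ * b * (g * c * g⁻¹) ∈ interior V := by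
    have hc : Continuous fun p : G × G × G => p.1⁻¹ * p.2.1 * (g * p.2.2 * g⁻¹) := by fun_prop
    have hev : ∀ᶠ p : G × G × G in 𝓝 (1, 1, 1), p.1⁻¹ * p.2.1 * (g * p.2.2 * g⁻¹) ∈ interior V :=
      hc.continuousAt.eventually_mem (isOpen_interior.mem_nhds (by simpa using h1V))
    obtain ⟨R₁, hR₁, R', hR', h₁⟩ := mem_nhds_prod_iff.1 hev
    obtain ⟨R₂, hR₂, R₃, hR₃, h₂⟩ := mem_nhds_prod_iff.1 hR'
    have hR := inter_mem hR₁ (inter_mem hR₂ hR₃)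
    refine ⟨_, inter_mem hR (inv_mem_nhds_one G hR), fun s hs => ⟨hs.2, by simpa using hs.1⟩, ?_⟩
    intro a ha b hb c hc
    exact h₁ (mk_mem_prod ha.1.1 (h₂ (mk_mem_prod hb.1.2.1 hc.1.2.2)))
  obtain ⟨n, A, hAo, hAw, hcov⟩ := exists_finite_coloring hO hV g
    (fun x hx v hv h => hx ⟨v, hv, h⟩) hS hSinv
  have hz' := closure_minimal hcov isClosed_closure hz
  rw [closure_iUnion_of_finite] at hz'
  obtain ⟨i, hi⟩ := mem_iUnion.1 hz'
  set T : Set X := {y | ∃ s ∈ S, ∃ a ∈ A i, s • a = y}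
  have hT : IsOpen T := isOpen_setOf_exists_smul_mem_eq S (hAo i)
  -- The preimage under `g⁻¹` is `g • T`. Since `g` fixes `z`, the point `z` lies in the closures of
  -- both `T` and `g • T`.
  refine disjoint_left.1 (hX ((fun x => g⁻¹ • x) ⁻¹' T) T
    (hT.preimage (continuous_const_smul _)) hT S hS ?_) ?_ hi
  · rintro w hw y ⟨s, hs, a, ha, hay⟩ ⟨s', hs', a', ha', h⟩
    refine hAw i a ha _ (hSV s' hs' w hw s hs) ?_
    have hy : y = g • s • a := by rw [hay, smul_inv_smul]
    have : (s'⁻¹ * w * (g * s * g⁻¹)) • g • a = a' := by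
      rw [← inv_smul_smul s' a', h, hy]
      simp only [mul_smul, inv_smul_smul]
    rwa [this]
  · have := map_mem_closure (continuous_const_smul g) hi
      (t := (fun x => g⁻¹ • x) ⁻¹' T) fun y hy => by simpa using hy
    rwa [hgz] at this

end Coloring

/-! ### The Gleason cover and its group action -/

section GleasonCover

/-- Two lifts to an irreducible cover agree, if their source is irreducible over the base. -/
theorem eq_of_lifts {E Z X : Type*} [TopologicalSpace E] [TopologicalSpace Z] [T2Space Z]
    {p : E → X} {ρ : Z → X} (hp : Function.Surjective p)
    (hpi : ∀ U : Set E, IsOpen U → U.Nonempty → ∃ x, p ⁻¹' {x} ⊆ U)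
    {f f' : E → Z} (hf : Continuous f) (hf' : Continuous f') (hfs : Function.Surjective f')
    (h : ∀ e, ρ (f e) = p e) (h' : ∀ e, ρ (f' e) = p e) (e : E) : f e = f' e := by
  by_contra hne
  obtain ⟨A, B, hA, hB, heA, heB, hAB⟩ := t2_separation hne
  obtain ⟨x, hx⟩ := hpi (f ⁻¹' A ∩ f' ⁻¹' B) ((hA.preimage hf).inter (hB.preimage hf')) ⟨e, heA, heB⟩
  obtain ⟨c, rfl⟩ := hp x
  obtain ⟨d, hd⟩ := hfs (f c)
  refine disjoint_left.1 hAB (hx (rfl : p c = p c)).1 ?_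
  rw [← hd]
  exact (hx (show p d = p c by rw [← h', hd, h])).2

theorem surjective_of_lift {E Z X : Type*} [TopologicalSpace E] [CompactSpace E]
    [TopologicalSpace Z] [T2Space Z] {p : E → X} {ρ : Z → X} (hp : Function.Surjective p)
    (hρ : ∀ U : Set Z, IsOpen U → U.Nonempty → ∃ x, ρ ⁻¹' {x} ⊆ U)
    {f : E → Z} (hf : Continuous f) (h : ∀ e, ρ (f e) = p e) : Function.Surjective f := by
  intro z
  by_contra hz
  obtain ⟨x, hx⟩ := hρ (range f)ᶜ (isCompact_range hf).isClosed.isOpen_compl ⟨z, hz⟩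
  obtain ⟨e, rfl⟩ := hp x
  exact hx (h e) (mem_range_self e)

/-- A minimal closed subset `E` of the Stone–Čech compactification still mapping onto `X` is
irreducible over `X`. Projectivity gives a map back to `E` over `X`, which is the identity on `E` by
uniqueness of lifts; so `E` is a retract of a projective space. -/
theorem exists_projective_cover_of_discrete {D X : Type u} [TopologicalSpace D]
    [DiscreteTopology D] [TopologicalSpace X] [CompactSpace X] [T2Space X] {s : D → X}
    (hs : Function.Surjective s) :
    ∃ (E : Type u) (_ : TopologicalSpace E) (_ : CompactSpace E) (_ : T2Space E) (p : E → X),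
      Continuous p ∧ Function.Surjective p ∧
      (∀ U : Set E, IsOpen U → U.Nonempty → ∃ x, p ⁻¹' {x} ⊆ U) ∧ CompactT2.Projective E := by
  let q : StoneCech D → X := stoneCechExtend (continuous_of_discreteTopology (f := s))
  have hq : Continuous q := continuous_stoneCechExtend _
  have hqs : Function.Surjective q := by
    intro x
    obtain ⟨d, rfl⟩ := hs x
    exact ⟨stoneCechUnit d, congrFun (stoneCechExtend_extends _) d⟩
  obtain ⟨E, hE, hEs, hEz⟩ := exists_compact_surjective_zorn_subset hq hqs
  let p : E → X := fun e => q e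
  have hp : Continuous p := hq.comp continuous_subtype_val
  have hps : Function.Surjective p := by
    intro x
    obtain ⟨e, he, rfl⟩ := hEs.ge (mem_univ x)
    exact ⟨⟨e, he⟩, rfl⟩
  have hpi : ∀ U : Set E, IsOpen U → U.Nonempty → ∃ x, p ⁻¹' {x} ⊆ U := by
    intro U hU hne
    have h := hEz Uᶜ (compl_ne_univ.2 hne) hU.isClosed_compl
    obtain ⟨x, hx⟩ := (ne_univ_iff_exists_notMem _).1 h
    refine ⟨x, fun e he => ?_⟩
    by_contra heU
    exact hx ⟨e, heU, he⟩
  obtain ⟨r, hr, hrq⟩ := StoneCech.projective hq hp hps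
  have hrE : ∀ e : E, r e = e :=
    eq_of_lifts (f := fun e : E => r e) (f' := id) (ρ := p) hps hpi
      (hr.comp continuous_subtype_val) continuous_id Function.surjective_id
      (fun e => congrFun hrq e) fun e => rfl
  refine ⟨E, inferInstance, hE, inferInstance, p, hp, hps, hpi, ?_⟩
  intro Y Z _ _ _ _ _ _ f g hf hg hgs
  obtain ⟨h, hh, hgh⟩ := StoneCech.projective (hf.comp hr) hg hgs
  refine ⟨fun e => h e, hh.comp continuous_subtype_val, funext fun e => ?_⟩
  have := congrFun hgh e
  simp only [Function.comp_apply, hrE] at this ⊢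
  exact this

/-- The Gleason cover of a compact Hausdorff space. -/
theorem exists_projective_cover (X : Type u) [TopologicalSpace X] [CompactSpace X] [T2Space X] :
    ∃ (E : Type u) (_ : TopologicalSpace E) (_ : CompactSpace E) (_ : T2Space E) (p : E → X),
      Continuous p ∧ Function.Surjective p ∧
      (∀ U : Set E, IsOpen U → U.Nonempty → ∃ x, p ⁻¹' {x} ⊆ U) ∧ CompactT2.Projective E :=
  @exists_projective_cover_of_discrete X X ⊥ (discreteTopology_bot X) _ _ _ id Function.surjective_id

/-- A group acting by homeomorphisms on a compact Hausdorff space acts on its Gleason cover. -/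
theorem exists_equivariant_projective_cover (G : Type*) [Group G] (X : Type u) [TopologicalSpace X]
    [CompactSpace X] [T2Space X] [MulAction G X] [ContinuousConstSMul G X] :
    ∃ (E : Type u) (_ : TopologicalSpace E) (_ : CompactSpace E) (_ : T2Space E)
      (_ : MulAction G E) (_ : ContinuousConstSMul G E) (p : E → X),
      IsIrreducibleExtension G p ∧ CompactT2.Projective E := by
  obtain ⟨E, _, _, _, p, hp, hps, hpi, hE⟩ := exists_projective_cover X
  have hlift : ∀ g : G, ∃ φ : E → E, Continuous φ ∧ ∀ e, p (φ e) = g • p e := by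
    intro g
    obtain ⟨φ, hφ, h⟩ := hE (hp.const_smul g) hp hps
    exact ⟨φ, hφ, congrFun h⟩
  choose φ hφ hφp using hlift
  have huniq : ∀ f : E → E, Continuous f → (∀ e, p (f e) = p e) → ∀ e, f e = e :=
    fun f hf h => eq_of_lifts (f' := id) (ρ := p) hps hpi hf continuous_id
      Function.surjective_id h fun _ => rfl
  let act : MulAction G E :=
    { smul := φ
      one_smul := huniq _ (hφ 1) fun e => (hφp 1 e).trans (one_smul G _)
      mul_smul := fun g h e => by
        -- Uniqueness only concerns self-maps over `X`, so `φ g ∘ φ h` and `φ (g * h)` are compared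
        -- after composing with `φ (g * h)⁻¹`.
        have h₁ := huniq _ ((hφ g).comp ((hφ h).comp (hφ (g * h)⁻¹))) (fun e => by
          simp only [Function.comp_apply, hφp, smul_smul]; simp) (φ (g * h) e)
        have h₂ := huniq _ ((hφ (g * h)⁻¹).comp (hφ (g * h))) (fun e => by
          simp only [Function.comp_apply, hφp, inv_smul_smul]) e
        simp only [Function.comp_apply] at h₁ h₂
        rw [h₂] at h₁
        exact h₁.symm }
  exact ⟨E, _, ‹_›, ‹_›, act, ⟨hφ⟩, p, ⟨⟨hp, hφp⟩, hps, hpi⟩, hE⟩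

end GleasonCover

/-! ### The largest jointly continuous quotient -/

section JointQuotient

variable (G : Type v) [Group G] [TopologicalSpace G]
  (E : Type u) [TopologicalSpace E] [MulAction G E]

/-- The functions on `E` along which the action is jointly continuous. -/
def jointlyContinuous : Set (E → ℝ) :=
  {f | Continuous fun q : G × E => f (q.1 • q.2)}

/-- Points of `E` are equivalent if no jointly continuous function separates them. -/
def jointSetoid : Setoid E where
  r e e' := ∀ f ∈ jointlyContinuous G E, f e = f e'
  iseqv := ⟨fun _ _ _ => rfl, fun h f hf => (h f hf).symm, fun h h' f hf =>
    (h f hf).trans (h' f hf)⟩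

/-- The largest quotient of `E` on which `G` acts jointly continuously. -/
def JointQuotient : Type u := Quotient (jointSetoid G E)

instance : TopologicalSpace (JointQuotient G E) :=
  inferInstanceAs (TopologicalSpace (Quotient (jointSetoid G E)))

instance [CompactSpace E] : CompactSpace (JointQuotient G E) :=
  inferInstanceAs (CompactSpace (Quotient (jointSetoid G E)))

variable {E}

/-- The quotient map. -/
def JointQuotient.mk (e : E) : JointQuotient G E := Quotient.mk (jointSetoid G E) e

variable {G}

theorem JointQuotient.continuous_mk : Continuous (JointQuotient.mk G : E → JointQuotient G E) :=
  continuous_quotient_mk'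

theorem JointQuotient.surjective_mk :
    Function.Surjective (JointQuotient.mk G : E → JointQuotient G E) :=
  Quotient.mk_surjective

theorem JointQuotient.mk_eq_mk {e e' : E} :
    JointQuotient.mk G e = JointQuotient.mk G e' ↔ ∀ f ∈ jointlyContinuous G E, f e = f e' :=
  Quotient.eq (r := jointSetoid G E)

theorem continuous_of_mem_jointlyContinuous {f : E → ℝ} (hf : f ∈ jointlyContinuous G E) :
    Continuous f := by
  have : Continuous fun e : E => f ((1 : G) • e) :=
    Continuous.comp (g := fun q : G × E => f (q.1 • q.2)) hf (Continuous.prodMk_right 1)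
  simpa using this

theorem exists_lift_of_mem_jointlyContinuous {f : E → ℝ} (hf : f ∈ jointlyContinuous G E) :
    ∃ F : JointQuotient G E → ℝ, Continuous F ∧ ∀ e, F (JointQuotient.mk G e) = f e :=
  ⟨Quotient.lift f fun _ _ h => h f hf,
    (continuous_of_mem_jointlyContinuous hf).quotient_lift _, fun _ => rfl⟩

instance : T2Space (JointQuotient G E) := by
  refine ⟨fun x y hxy => ?_⟩
  obtain ⟨a, rfl⟩ := JointQuotient.surjective_mk x
  obtain ⟨b, rfl⟩ := JointQuotient.surjective_mk y
  rw [Ne, JointQuotient.mk_eq_mk] at hxy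
  push Not at hxy
  obtain ⟨f, hf, hne⟩ := hxy
  obtain ⟨F, hF, hFf⟩ := exists_lift_of_mem_jointlyContinuous hf
  exact separated_by_continuous hF (by rwa [hFf, hFf])

/-- Continuity of a map into the quotient is tested on the jointly continuous functions. -/
theorem JointQuotient.continuous_mk_comp [CompactSpace E] {Z : Type*} [TopologicalSpace Z]
    {k : Z → E} (hk : ∀ f ∈ jointlyContinuous G E, Continuous fun z => f (k z)) :
    Continuous fun z => JointQuotient.mk G (k z) := by
  choose F hF hFf using fun f : jointlyContinuous G E => exists_lift_of_mem_jointlyContinuous f.2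
  have hFc : Continuous fun (x : JointQuotient G E) f => F f x := continuous_pi hF
  have hinj : Function.Injective fun (x : JointQuotient G E) f => F f x := by
    intro x y hxy
    obtain ⟨a, rfl⟩ := JointQuotient.surjective_mk x
    obtain ⟨b, rfl⟩ := JointQuotient.surjective_mk y
    refine JointQuotient.mk_eq_mk.2 fun f hf => ?_
    simpa only [hFf] using congrFun hxy ⟨f, hf⟩
  rw [(hFc.isClosedEmbedding hinj).isInducing.continuous_iff]
  refine continuous_pi fun f => ?_
  simp only [Function.comp_apply, hFf]
  exact hk f f.2

variable [IsTopologicalGroup G]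

theorem smul_mem_jointlyContinuous {f : E → ℝ} (hf : f ∈ jointlyContinuous G E) (g : G) :
    (fun e => f (g • e)) ∈ jointlyContinuous G E := by
  have : Continuous fun q : G × E => f ((g * q.1) • q.2) :=
    Continuous.comp (g := fun q : G × E => f (q.1 • q.2)) hf
      (f := fun q : G × E => (g * q.1, q.2)) (by fun_prop)
  simpa only [jointlyContinuous, mem_ofPred_eq, mul_smul] using this

instance : MulAction G (JointQuotient G E) where
  smul g := Quotient.map (g • ·) fun _ _ h _ hf => h _ (smul_mem_jointlyContinuous hf g)
  one_smul x := by
    obtain ⟨e, rfl⟩ := JointQuotient.surjective_mk x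
    exact congrArg (JointQuotient.mk G) (one_smul G e)
  mul_smul g h x := by
    obtain ⟨e, rfl⟩ := JointQuotient.surjective_mk x
    exact congrArg (JointQuotient.mk G) (mul_smul g h e)

/-- A product with `G` need not preserve quotient maps, but `mk` is proper, being continuous from a
compact to a Hausdorff space. Hence `id × mk` is closed and a quotient map, and continuity can be
checked on `G × E`. -/
instance [CompactSpace E] : ContinuousSMul G (JointQuotient G E) := by
  refine ⟨?_⟩
  have hproper : IsProperMap (JointQuotient.mk G : E → JointQuotient G E) :=
    JointQuotient.continuous_mk.isProperMap
  have hp := (isProperMap_id (X := G)).prodMap hproper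
  have hq : IsQuotientMap (Prod.map id (JointQuotient.mk G : E → JointQuotient G E)) :=
    hp.isClosedMap.isQuotientMap hp.continuous
      (Function.surjective_id.prodMap JointQuotient.surjective_mk)
  rw [hq.continuous_iff]
  exact JointQuotient.continuous_mk_comp (k := fun q : G × E => q.1 • q.2) fun f hf => hf

/-- An equivariant map from `E` to a flow factors through the quotient. -/
theorem JointQuotient.exists_lift {Z : Type*} [TopologicalSpace Z] [CompactSpace Z] [T2Space Z]
    [MulAction G Z] [ContinuousSMul G Z] {r : E → Z} (hr : IsGMap G r) :
    ∃ R : JointQuotient G E → Z, IsGMap G R ∧ ∀ e, R (JointQuotient.mk G e) = r e := by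
  have hwell : ∀ a b, (jointSetoid G E).r a b → r a = r b := by
    intro a b hab
    by_contra hne
    obtain ⟨f, hfa, hfb, -⟩ := exists_continuous_zero_one_of_isClosed
      (isClosed_singleton (x := r a)) (isClosed_singleton (x := r b)) (by simpa using hne)
    -- A Urysohn function on `Z` pulled back along `r` is jointly continuous because `Z` is a flow.
    have := hab (fun e => f (r e)) (by
      have hc := hr.continuous
      simp only [jointlyContinuous, mem_ofPred_eq, hr.map_smul]
      fun_prop)
    rw [hfa (mem_singleton _), hfb (mem_singleton _)] at this
    simp at this
  refine ⟨Quotient.lift r hwell, ⟨hr.continuous.quotient_lift hwell, ?_⟩, fun _ => rfl⟩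
  intro g x
  obtain ⟨e, rfl⟩ := JointQuotient.surjective_mk x
  exact hr.map_smul g e

end JointQuotient

/-! ### Separating uniformly disjoint open sets -/

section Separation

/-- Every neighborhood of the identity of a locally compact group contains the unit ball of a
continuous length function. -/
theorem exists_length_function {G : Type*} [Group G] [TopologicalSpace G] [IsTopologicalGroup G]
    [LocallyCompactSpace G] [T2Space G] {W : Set G} (hW : W ∈ 𝓝 1) :
    ∃ ρ : G → ℝ, (∀ g, 0 ≤ ρ g) ∧ ρ 1 = 0 ∧ (∀ g h, ρ (g * h) ≤ ρ g + ρ h) ∧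
      Tendsto ρ (𝓝 1) (𝓝 0) ∧ ∀ g, ρ g < 1 → g ∈ W := by
  obtain ⟨φ, hφ1, hφW, hφc, hφ01⟩ := exists_continuous_one_zero_of_isCompact
    (isCompact_singleton (x := (1 : G))) (isOpen_interior (s := W)).isClosed_compl
    (by simpa using mem_interior_iff_mem_nhds.2 hW)
  have hbd : ∀ g, BddAbove (range fun x => |φ (g * x) - φ x|) := by
    refine fun g => ⟨1, ?_⟩
    rintro _ ⟨x, rfl⟩
    have h₁ := hφ01 (g * x)
    have h₂ := hφ01 x
    exact abs_le.2 ⟨by linarith [h₁.1, h₂.2], by linarith [h₁.2, h₂.1]⟩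
  have hle : ∀ g x, |φ (g * x) - φ x| ≤ ⨆ x, |φ (g * x) - φ x| := fun g x => le_ciSup (hbd g) x
  have hnn : ∀ g, 0 ≤ ⨆ x, |φ (g * x) - φ x| := fun g => (abs_nonneg _).trans (hle g 1)
  -- The sup-distance between a bump function `φ` at `1` and its translate. If `g ∉ W`, evaluating
  -- at `x = 1` gives at least `1`.
  refine ⟨fun g => ⨆ x, |φ (g * x) - φ x|, hnn, by simp, fun g h => ciSup_le fun x => ?_, ?_,
    fun g hg => ?_⟩
  · have h₁ := hle g (h * x)
    have h₂ := hle h x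
    rw [mul_assoc]
    exact (abs_sub_le _ (φ (h * x)) _).trans (add_le_add h₁ h₂)
  · let := IsTopologicalGroup.rightUniformSpace G
    have : IsRightUniformGroup G := ⟨rfl⟩
    have hu : UniformContinuous φ := hφc.uniformContinuous_of_continuous φ.continuous
    rw [Metric.tendsto_nhds]
    intro ε hε
    have hmem := hu (Metric.dist_mem_uniformity (half_pos hε))
    rw [mem_map, uniformity_eq_comap_mul_inv_nhds_one, mem_comap] at hmem
    obtain ⟨N, hN, hNs⟩ := hmem
    filter_upwards [hN] with g hg
    rw [Real.dist_0_eq_abs, abs_of_nonneg (hnn g)]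
    refine lt_of_le_of_lt (ciSup_le fun x => ?_) (half_lt_self hε)
    have : dist (φ x) (φ (g * x)) < ε / 2 := hNs (show (x, g * x) ∈ _ by simpa using hg)
    rw [dist_comm, Real.dist_eq] at this
    exact this.le
  · by_contra hgW
    have h := hle g 1
    rw [mul_one, hφW (fun h => hgW (interior_subset h)), hφ1 (mem_singleton _)] at h
    simp only [Pi.zero_apply, Pi.one_apply, zero_sub, abs_neg, abs_one] at h
    exact absurd hg h.not_gt

/-- On an extremally disconnected space, uniformly disjoint open sets are separated by a jointly
continuous function. -/
theorem exists_jointlyContinuous_separating {G : Type*} [Group G] [TopologicalSpace G]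
    [IsTopologicalGroup G] [LocallyCompactSpace G] [T2Space G] {E : Type*} [TopologicalSpace E]
    [ExtremallyDisconnected E] [MulAction G E] [ContinuousConstSMul G E]
    {A B : Set E} (hA : IsOpen A) (hB : IsOpen B) {W : Set G} (hW : W ∈ 𝓝 1)
    (h : ∀ w ∈ W, ∀ a ∈ A, w • a ∉ B) :
    ∃ f ∈ jointlyContinuous G E, (∀ a ∈ A, f a ≤ 0) ∧ ∀ b ∈ B, 1 ≤ f b := by
  obtain ⟨ρ, hρ0, hρ1, hρmul, hρlim, hρW⟩ := exists_length_function hW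
  let U : ℝ → Set E := fun r => {y | ∃ g ∈ {g | ρ g < r}, ∃ a ∈ A, g • a = y}
  have hUo : ∀ r, IsOpen (U r) := fun r => isOpen_setOf_exists_smul_mem_eq _ hA
  -- The closures of the `ρ`-thickenings `U r` of `A` are clopen, and serve as the level sets of a
  -- Urysohn function truncated at `1`.
  have hUmono : ∀ {r s}, r ≤ s → closure (U r) ⊆ closure (U s) := fun hrs =>
    closure_mono fun y ⟨g, hg, a, ha, hy⟩ => ⟨g, lt_of_lt_of_le hg hrs, a, ha, hy⟩
  have hUsmul : ∀ r g e, e ∈ closure (U r) → g • e ∈ closure (U (r + ρ g)) := by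
    intro r g e he
    refine map_mem_closure (continuous_const_smul g) he ?_
    rintro _ ⟨k, hk, a, ha, rfl⟩
    refine ⟨g * k, ?_, a, ha, mul_smul _ _ _⟩
    have hk' : ρ k < r := hk
    have := hρmul g k
    show ρ (g * k) < r + ρ g
    linarith
  let S : E → Set ℝ := fun e => {r | 1 ≤ r ∨ e ∈ closure (U r)}
  have hSne : ∀ e, (S e).Nonempty := fun e => ⟨1, Or.inl le_rfl⟩
  have hS0 : ∀ e, ∀ r ∈ S e, 0 ≤ r := by
    rintro e r (hr | hr)
    · linarith
    · by_contra hr0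
      have : U r = ∅ := eq_empty_of_forall_notMem fun y ⟨g, hg, _⟩ =>
        absurd (lt_trans (lt_of_le_of_lt (hρ0 g) hg) (not_le.1 hr0)) (lt_irrefl _)
      simp [this] at hr
  have hSbd : ∀ e, BddBelow (S e) := fun e => ⟨0, hS0 e⟩
  have hSup : ∀ e r s, r ∈ S e → r ≤ s → s ∈ S e := by
    rintro e r s (hr | hr) hrs
    · exact Or.inl (hr.trans hrs)
    · exact Or.inr (hUmono hrs hr)
  let f : E → ℝ := fun e => sInf (S e)
  have hfc : Continuous f := by
    rw [continuous_iff_continuousAt]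
    refine fun e => tendsto_order.2 ⟨fun r hr => ?_, fun r hr => ?_⟩
    · obtain ⟨s, hrs, hs⟩ := exists_between hr
      have hsS : s ∉ S e := notMem_of_lt_csInf hs (hSbd e)
      have hs1 : ¬ 1 ≤ s := fun h => hsS (Or.inl h)
      have heU : e ∉ closure (U s) := fun h => hsS (Or.inr h)
      filter_upwards [isClosed_closure.isOpen_compl.mem_nhds heU] with y hy
      refine lt_of_lt_of_le hrs (le_csInf (hSne y) fun t ht => ?_)
      by_contra hts
      exact (hSup y t s ht (not_le.1 hts).le).elim hs1 hy
    · obtain ⟨s, hs, hsr⟩ := exists_lt_of_csInf_lt (hSne e) hr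
      rcases hs with hs | hs
      · exact Eventually.of_forall fun y =>
          lt_of_le_of_lt (csInf_le (hSbd y) (Or.inl hs)) hsr
      · filter_upwards [(ExtremallyDisconnected.open_closure _ (hUo s)).mem_nhds hs] with y hy
        exact lt_of_le_of_lt (csInf_le (hSbd y) (Or.inr hy)) hsr
  -- This Lipschitz bound along orbits upgrades continuity of `f` to joint continuity.
  have hfle : ∀ g e, f (g • e) ≤ f e + ρ g := by
    intro g e
    rw [← sub_le_iff_le_add]
    refine le_csInf (hSne e) fun r hr => ?_
    rw [sub_le_iff_le_add]
    refine csInf_le (hSbd _) ?_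
    rcases hr with hr | hr
    · exact Or.inl (by linarith [hρ0 g])
    · exact Or.inr (hUsmul r g e hr)
  refine ⟨f, ?_, fun a ha => ?_, fun b hb => ?_⟩
  · show Continuous fun q : G × E => f (q.1 • q.2)
    rw [continuous_iff_continuousAt]
    rintro ⟨g₀, e₀⟩
    have hbase : Tendsto (fun q : G × E => f (g₀ • q.2)) (𝓝 (g₀, e₀)) (𝓝 (f (g₀ • e₀))) :=
      (hfc.comp ((continuous_const_smul g₀).comp continuous_snd)).tendsto (g₀, e₀)
    have h₁ : Tendsto (fun q : G × E => ρ (q.1 * g₀⁻¹)) (𝓝 (g₀, e₀)) (𝓝 0) := by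
      refine hρlim.comp ?_
      have hc : Continuous fun q : G × E => q.1 * g₀⁻¹ := by fun_prop
      simpa using hc.tendsto (g₀, e₀)
    have h₂ : Tendsto (fun q : G × E => ρ (g₀ * q.1⁻¹)) (𝓝 (g₀, e₀)) (𝓝 0) := by
      refine hρlim.comp ?_
      have hc : Continuous fun q : G × E => g₀ * q.1⁻¹ := by fun_prop
      simpa using hc.tendsto (g₀, e₀)
    have hlow := hbase.sub h₂
    have hup := hbase.add h₁
    rw [sub_zero] at hlow
    rw [add_zero] at hup
    refine tendsto_of_tendsto_of_tendsto_of_le_of_le hlow hup (fun q => ?_) fun q => ?_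
    · have := hfle (g₀ * q.1⁻¹) (q.1 • q.2)
      rw [mul_smul, inv_smul_smul] at this
      exact sub_le_iff_le_add.2 this
    · have := hfle (q.1 * g₀⁻¹) (g₀ • q.2)
      rwa [mul_smul, inv_smul_smul] at this
  · refine le_of_forall_pos_le_add fun ε hε => ?_
    rw [zero_add]
    exact csInf_le (hSbd a) (Or.inr (subset_closure ⟨1, by simpa [hρ1] using hε, a, ha, one_smul _ _⟩))
  · refine le_csInf (hSne b) fun r hr => ?_
    rcases hr with hr | hr
    · exact hr
    · by_contra hr1
      obtain ⟨_, hyB, g, hg, a, ha, rfl⟩ := mem_closure_iff.1 hr B hB hb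
      exact h g (hρW g (lt_trans hg (not_le.1 hr1))) a ha hyB

end Separation

/-! ### The universal irreducible extension -/

/-- Every flow has a universal irreducible extension, and the stabilizer map of the latter is
continuous. -/
theorem exists_universal_irreducible_extension (G : Type v) [Group G] [TopologicalSpace G]
    [IsTopologicalGroup G] [LocallyCompactSpace G] [T2Space G] (X : Type u) [TopologicalSpace X]
    [CompactSpace X] [T2Space X] [MulAction G X] [ContinuousSMul G X] :
    ∃ (Y : Type u) (_ : TopologicalSpace Y) (_ : CompactSpace Y) (_ : T2Space Y)
      (_ : MulAction G Y) (_ : ContinuousSMul G Y) (π : Y → X),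
      IsUniversalIrreducibleExtension G π ∧
        Continuous (stabilizerMap G : Y → ClosedSubgroup G) := by
  obtain ⟨E, _, _, _, _, _, p, hp, hE⟩ := exists_equivariant_projective_cover G X
  have : ExtremallyDisconnected E := hE.extremallyDisconnected
  obtain ⟨π, hπ, hπp⟩ := JointQuotient.exists_lift hp.toIsGMap
  refine ⟨JointQuotient G E, inferInstance, inferInstance, inferInstance, inferInstance,
    inferInstance, π, ⟨⟨hπ, ?_, ?_⟩, ?_⟩, continuous_stabilizerMap ?_⟩
  · intro x
    obtain ⟨e, rfl⟩ := hp.surjective x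
    exact ⟨_, hπp e⟩
  · rintro U hU ⟨y, hy⟩
    obtain ⟨e, rfl⟩ := JointQuotient.surjective_mk y
    obtain ⟨x, hx⟩ := hp.exists_fiber_subset _ (hU.preimage JointQuotient.continuous_mk) ⟨e, hy⟩
    refine ⟨x, fun z hz => ?_⟩
    obtain ⟨d, rfl⟩ := JointQuotient.surjective_mk z
    exact hx ((hπp d).symm.trans hz)
  · intro Z _ _ _ _ _ ρ hρ
    obtain ⟨q, hq, hqρ⟩ := hE hp.continuous hρ.continuous hρ.surjective
    have hqp : ∀ e, ρ (q e) = p e := congrFun hqρ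
    have hqs := surjective_of_lift hp.surjective hρ.exists_fiber_subset hq hqp
    -- Conjugating `q` by `g` gives another lift of `p`, so uniqueness of lifts forces equivariance.
    have hqG : IsGMap G q := by
      refine ⟨hq, fun g e => ?_⟩
      have := eq_of_lifts (ρ := ρ) (f := fun e => g⁻¹ • q (g • e)) hp.surjective
        hp.exists_fiber_subset (by fun_prop) hq hqs
        (fun e => by rw [hρ.map_smul, hqp, hp.map_smul, inv_smul_smul]) hqp e
      rw [← this, smul_inv_smul]
    obtain ⟨R, hR, hRq⟩ := JointQuotient.exists_lift hqG
    refine ⟨R, hR, fun y => ?_⟩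
    obtain ⟨e, rfl⟩ := JointQuotient.surjective_mk y
    rw [hRq, hqp, hπp]
  · intro A B hA hB W hW hAB
    obtain ⟨f, hf, hfA, hfB⟩ := exists_jointlyContinuous_separating
      (hA.preimage (JointQuotient.continuous_mk (G := G) (E := E)))
      (hB.preimage JointQuotient.continuous_mk) hW fun w hw a ha => hAB w hw _ ha
    obtain ⟨F, hF, hFf⟩ := exists_lift_of_mem_jointlyContinuous hf
    have h₁ : closure A ⊆ {y | F y ≤ 0} := by
      refine closure_minimal (fun y hy => ?_) (isClosed_le hF continuous_const)
      obtain ⟨e, rfl⟩ := JointQuotient.surjective_mk y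
      exact (hFf e).trans_le (hfA e hy)
    have h₂ : closure B ⊆ {y | 1 ≤ F y} := by
      refine closure_minimal (fun y hy => ?_) (isClosed_le continuous_const hF)
      obtain ⟨e, rfl⟩ := JointQuotient.surjective_mk y
      exact (hfB e hy).trans_eq (hFf e).symm
    refine disjoint_left.2 fun y hyA hyB => ?_
    have h₃ : F y ≤ 0 := h₁ hyA
    have h₄ : 1 ≤ F y := h₂ hyB
    linarith

end GFlow

theorem corollary5p4 {G : Type v} [Group G] [TopologicalSpace G] [IsTopologicalGroup G]
    [LocallyCompactSpace G] [T2Space G] [SecondCountableTopology G]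
    {X : Type u} [TopologicalSpace X] [CompactSpace X] [T2Space X] [MulAction G X]
    [ContinuousSMul G X] :
    Dense (GFlow.continuityPoints G X) ∧ IsGδ (GFlow.continuityPoints G X) ∧
      GFlow.stabilizerFlow G X =
        closure ((GFlow.stabilizerMap G : X → ClosedSubgroup G) '' GFlow.continuityPoints G X) := by
  obtain ⟨hd, hG⟩ := GFlow.dense_and_isGδ_continuityPoints (G := G) (X := X)
  obtain ⟨Y, _, _, _, _, _, π, hπ, hc⟩ := GFlow.exists_universal_irreducible_extension G X
  exact ⟨hd, hG, hπ.stabilizerFlow_eq_closure hd hc⟩
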